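/- Let $\Omega$ be a standard Borel space with an atomless probability measure $\nu$, and let $W:\Omega\times\Omega\to[0,1]$ be a graphon, i.e. a symmetric measurable function. All subsets of $\Omega$ below are measurable. For a finite simple graph $H$ put $$t(H,W)=\int_{\Omega^{V(H)}}\prod_{uv\in E(H)}W(x_u,x_v)\,d\nu^{\otimes V(H)},\qquad t_{\mathrm{ind}}(H,W)=\int_{\Omega^{V(H)}}\prod_{uv\in E(H)}W(x_u,x_v)\prod_{uv\notin E(H)}\bigl(1-W(x_u,x_v)\bigr)\,d\nu^{\otimes V(H)},$$ where $uv$ ranges over unordered pairs of distinct vertices of $H$. A set $I\subseteq\Omega$ is independent in $W$ if $W=0$ almost everywhere on $I\times I$. The chromatic number $\chi(W)$ is the least $k\in\mathbb{N}$ for which there is a measurable $f:\Omega\to\{1,\dots,k\}$ all of whose fibres $f^{-1}(i)$ are independent ($\chi(W)=\infty$ if there is no such $k$), and the clique number is $\omega(W)=\max\{r: t(K_r,W)>0\}$ ($\omega(W)=\infty$ if there are arbitrarily large such $r$). For $A\subseteq\Omega$ with $\nu(A)>0$, $W[A]$ denotes the restriction of $W$ to $A\times A$, regarded as a graphon on $A$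 with the probability measure $\nu_A(B)=\nu(B)/\nu(A)$. **Theorem.** Suppose that $W$ is properly subgraph-perfect, that is, $\chi(H)=\omega(H)$ for every finite graph $H$ with $t_{\mathrm{ind}}(H,W)>0$, and $\chi(W)<\infty$. Then $W$ is inheritance-perfect, that is, $\chi(W[A])=\omega(W[A])$ for every $A\subseteq\Omega$ of positive measure. -/

import Mathlib

open MeasureTheory

/-- A graphon on the space `Ω` with measure `ν`: a symmetric measurable function
`Ω × Ω → [0, 1]`. The measure is a parameter because all notions attached to a graphon
depend on it. -/
structure Graphon {Ω : Type*} [MeasurableSpace Ω] (ν : Measure Ω) where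
  /-- The underlying function. -/
  toFun : Ω → Ω → ℝ
  symm' : ∀ x y, toFun x y = toFun y x
  measurable' : Measurable (fun p : Ω × Ω => toFun p.1 p.2)
  nonneg' : ∀ x y, 0 ≤ toFun x y
  le_one' : ∀ x y, toFun x y ≤ 1

namespace Graphon

/-- The probability measure `ν_A(B) = ν(B) / ν(A)` on the subspace `A`. -/
noncomputable def subMeasure {Ω : Type*} [MeasurableSpace Ω] (ν : Measure Ω) (A : Set Ω) :
    Measure A :=
  (ν A)⁻¹ • ν.comap (Subtype.val : A → Ω)

/-- The subgraphon `W[A]`: the restriction of `W` to `A × A`, on the space `A` with the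
measure `ν_A`. -/
noncomputable def restrict {Ω : Type*} [MeasurableSpace Ω] {ν : Measure Ω} (W : Graphon ν)
    (A : Set Ω) : Graphon (subMeasure ν A) where
  toFun x y := W.toFun x y
  symm' x y := W.symm' x y
  measurable' := W.measurable'.comp
    ((measurable_subtype_coe.comp measurable_fst).prodMk
      (measurable_subtype_coe.comp measurable_snd))
  nonneg' x y := W.nonneg' x y
  le_one' x y := W.le_one' x y

/-- The value `W(x_u, x_v)` attached to the unordered pair `uv`. -/
def pairValue {Ω : Type*} [MeasurableSpace Ω] {ν : Measure Ω} (W : Graphon ν)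
    {V : Type*} (x : V → Ω) (e : Sym2 V) : ℝ :=
  Sym2.lift ⟨fun u v => W.toFun (x u) (x v), fun u v => W.symm' (x u) (x v)⟩ e

open Classical in
/-- The density `t(H, W) = ∫ ∏_{uv ∈ E(H)} W(x_u, x_v)`. -/
noncomputable def density {Ω : Type*} [MeasurableSpace Ω] {ν : Measure Ω} {V : Type*}
    [Fintype V] (H : SimpleGraph V) (W : Graphon ν) : ℝ :=
  ∫ x : V → Ω, ∏ e ∈ H.edgeFinset, W.pairValue x e ∂(Measure.pi fun _ => ν)

open Classical in
/-- The induced density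
`t_ind(H, W) = ∫ ∏_{uv ∈ E(H)} W(x_u, x_v) ∏_{uv ∉ E(H)} (1 - W(x_u, x_v))`, where the second
product is over the unordered pairs of distinct nonadjacent vertices. -/
noncomputable def inducedDensity {Ω : Type*} [MeasurableSpace Ω] {ν : Measure Ω} {V : Type*}
    [Fintype V] (H : SimpleGraph V) (W : Graphon ν) : ℝ :=
  ∫ x : V → Ω, (∏ e ∈ H.edgeFinset, W.pairValue x e) *
    ∏ e ∈ Hᶜ.edgeFinset, (1 - W.pairValue x e) ∂(Measure.pi fun _ => ν)

/-- `A` is an independent set of `W`: a measurable set such that `W` is zero almost everywhere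
on `A × A`. -/
def IsIndependent {Ω : Type*} [MeasurableSpace Ω] {ν : Measure Ω} (W : Graphon ν)
    (A : Set Ω) : Prop :=
  MeasurableSet A ∧ ∀ᵐ p ∂(ν.prod ν), p ∈ A ×ˢ A → W.toFun p.1 p.2 = 0

/-- `f` is a proper coloring of `W` with `k` colors: it is measurable and all its color classes
are independent sets. -/
def IsProperColoring {Ω : Type*} [MeasurableSpace Ω] {ν : Measure Ω} (W : Graphon ν)
    {k : ℕ} (f : Ω → Fin k) : Prop :=
  Measurable f ∧ ∀ i : Fin k, W.IsIndependent (f ⁻¹' {i})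

/-- The chromatic number `χ(W)`: the least number of colors in a proper coloring, and `⊤` if
there is no proper coloring with finitely many colors. -/
noncomputable def chromaticNumber {Ω : Type*} [MeasurableSpace Ω] {ν : Measure Ω}
    (W : Graphon ν) : ℕ∞ :=
  sInf {n : ℕ∞ | ∃ k : ℕ, n = k ∧ ∃ f : Ω → Fin k, W.IsProperColoring f}

/-- The clique number `ω(W)`: the largest `r` with `t(K_r, W) > 0`, and `⊤` if there are
arbitrarily large such `r`. -/
noncomputable def cliqueNumber {Ω : Type*} [MeasurableSpace Ω] {ν : Measure Ω}
    (W : Graphon ν) : ℕ∞ :=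
  sSup {n : ℕ∞ | ∃ r : ℕ, n = r ∧ 0 < density (⊤ : SimpleGraph (Fin r)) W}

/-- `W` is subgraph-perfect: `χ(H) = ω(H)` for every finite graph `H` with
`t_ind(H, W) > 0`. -/
def IsSubgraphPerfect {Ω : Type*} [MeasurableSpace Ω] {ν : Measure Ω} (W : Graphon ν) : Prop :=
  ∀ (n : ℕ) (H : SimpleGraph (Fin n)), 0 < inducedDensity H W →
    H.chromaticNumber = (H.cliqueNum : ℕ∞)

/-- `W` is properly subgraph-perfect: it is subgraph-perfect and `χ(W) < ∞`. -/
def IsProperlySubgraphPerfect {Ω : Type*} [MeasurableSpace Ω] {ν : Measure Ω}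
    (W : Graphon ν) : Prop :=
  W.IsSubgraphPerfect ∧ W.chromaticNumber < ⊤

/-- `W` is inheritance-perfect: `χ(W[A]) = ω(W[A])` for every measurable set `A` of positive
measure. -/
def IsInheritancePerfect {Ω : Type*} [MeasurableSpace Ω] {ν : Measure Ω}
    (W : Graphon ν) : Prop :=
  ∀ A : Set Ω, MeasurableSet A → 0 < ν A →
    (W.restrict A).chromaticNumber = (W.restrict A).cliqueNumber

end Graphon

/-! Subgraph-perfection passes to every `W[A]`, so it suffices to prove `χ(W) = ω(W)`. Pigeonhole
gives `ω ≤ χ`. If `ω(W) = r` is finite, the support graph of almost every finite sample has positive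
induced density and no clique of order `r + 1`; perfection makes it `r`-colorable.

`exists_isProperColoring` turns these finite colorings into one of `W`. Let `G` join distinct points
whose pair is a density point of `{W > 0}`, up to a null set. Resampling each vertex of a finite
subgraph of `G` near its position keeps `W` positive on all edges with positive probability, so
every finite subgraph is colorable, and so is `G` by compactness. The color classes need not be
measurable, but their measurable hulls are still independent (`ae_notMem_of_hull`). -/

open ProbabilityTheory Filter Topology

namespace Graphon

/-! ### Product measures and independent coordinates -/

section Products

variable {Ω : Type*} [MeasurableSpace Ω]

/-- A product of rescaled restrictions of a measure is absolutely continuous with respect to the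
power of that measure. -/
lemma pi_absolutelyContinuous {ι : Type*} [Fintype ι] {ν : Measure Ω} [SigmaFinite ν]
    {μ : ι → Measure Ω} [∀ i, SigmaFinite (μ i)] (c : ι → ENNReal) (U : ι → Set Ω)
    (h : ∀ i, μ i = c i • ν.restrict (U i)) :
    Measure.pi μ ≪ Measure.pi fun _ => ν := by
  have key : Measure.pi μ =
      (∏ i, c i) • (Measure.pi fun _ : ι => ν).restrict (Set.univ.pi U) := by
    rw [Measure.restrict_pi_pi]
    refine Measure.pi_eq fun s _ => ?_
    rw [Measure.smul_apply, Measure.pi_pi, smul_eq_mul, ← Finset.prod_mul_distrib]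
    exact Finset.prod_congr rfl fun i _ => by rw [h i]; rfl
  rw [key]
  exact Measure.absolutelyContinuous_of_le Measure.restrict_le_self |>.smul_left _

/-- Two distinct coordinates of a product of probability measures are independent. -/
lemma measurePreserving_eval_pair {ι : Type*} [Fintype ι] (μ : ι → Measure Ω)
    [∀ i, IsProbabilityMeasure (μ i)] {i j : ι} (hij : i ≠ j) :
    MeasurePreserving (fun y : ι → Ω => (y i, y j)) (Measure.pi μ) ((μ i).prod (μ j)) := by
  refine ⟨by fun_prop, ?_⟩
  have hind := (iIndepFun_pi (μ := μ) (X := fun _ => id) fun _ => aemeasurable_id).indepFun hij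
  have := (indepFun_iff_map_prod_eq_prod_map_map (measurable_pi_apply i).aemeasurable
    (measurable_pi_apply j).aemeasurable).1 hind
  exact this.trans (by
    rw [← (measurePreserving_eval μ i).map_eq, ← (measurePreserving_eval μ j).map_eq])

/-- Selecting distinct coordinates preserves power measures. -/
lemma measurePreserving_comp_injective {ι κ : Type*} [Fintype ι] [Fintype κ] (ν : Measure Ω)
    [IsProbabilityMeasure ν] {s : κ → ι} (hs : Function.Injective s) :
    MeasurePreserving (fun (y : ι → Ω) k => y (s k)) (Measure.pi fun _ => ν)
      (Measure.pi fun _ => ν) := by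
  refine ⟨by fun_prop, ?_⟩
  have hind := (iIndepFun_pi (μ := fun _ : ι => ν) (X := fun _ => id)
    fun _ => aemeasurable_id).precomp hs
  have := (iIndepFun_iff_map_fun_eq_pi_map
    fun k => (measurable_pi_apply (s k)).aemeasurable).1 hind
  refine this.trans ?_
  congr 1
  funext k
  exact (measurePreserving_eval (fun _ => ν) (s k)).map_eq

lemma cond_prod_cond (ν : Measure Ω) [IsProbabilityMeasure ν] {A B : Set Ω} :
    (ν[|A]).prod (ν[|B]) = (ν.prod ν)[|A ×ˢ B] := by
  unfold ProbabilityTheory.cond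
  rw [Measure.prod_smul_left, Measure.prod_smul_right, Measure.prod_restrict, smul_smul,
    Measure.prod_prod, ENNReal.mul_inv (by simp) (by simp)]

end Products

/-! ### Density points and measurable hulls -/

section Density

variable {Ω : Type*} [MeasurableSpace Ω] [StandardBorelSpace Ω]

/-- A density theorem for the square of a standard Borel probability space: there are
sets `U x r`, the preimages of balls under an embedding into `ℝ`, such that almost every point of
a measurable set `S` is a density point of `S` with respect to the products of these sets. -/
lemma exists_density_basis (ν : Measure Ω) [IsProbabilityMeasure ν] {S : Set (Ω × Ω)}
    (hS : MeasurableSet S) :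
    ∃ U : Ω → ℝ → Set Ω,
      ∀ᵐ p ∂ν.prod ν, p ∈ S →
        Tendsto (fun r => (ν.prod ν)[|U p.1 r ×ˢ U p.2 r] S) (𝓝[>] 0) (𝓝 1) := by
  set e := embeddingReal Ω
  have he : MeasurableEmbedding e := measurableEmbedding_embeddingReal Ω
  have he2 : MeasurableEmbedding (Prod.map e e) := he.prodMap he
  have := Measure.isProbabilityMeasure_map (μ := ν) he.measurable.aemeasurable
  have hmap : (ν.prod ν).map (Prod.map e e) = (ν.map e).prod (ν.map e) :=
    (Measure.map_prod_map ν ν he.measurable he.measurable).symm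
  refine ⟨fun x r => e ⁻¹' Metric.closedBall (e x) r, ?_⟩
  have h := Besicovitch.ae_tendsto_measure_inter_div_of_measurableSet ((ν.map e).prod (ν.map e))
    (he2.measurableSet_image.2 hS)
  rw [← hmap, he2.ae_map_iff] at h
  filter_upwards [h] with p hp hpS
  rw [Set.indicator_of_mem (Set.mem_image_of_mem _ hpS)] at hp
  refine hp.congr fun r => ?_
  -- Balls of the sup metric are products of balls, so the density theorem speaks of rectangles.
  have hball : Prod.map e e ⁻¹' Metric.closedBall (Prod.map e e p) r =
      (e ⁻¹' Metric.closedBall (e p.1) r) ×ˢ (e ⁻¹' Metric.closedBall (e p.2) r) := by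
    rw [← Set.preimage_prod_map_prod, closedBall_prod_same]; rfl
  rw [he2.map_apply, he2.map_apply, Set.preimage_inter, hball,
    Set.preimage_image_eq _ he2.injective, cond_apply', ENNReal.div_eq_inv_mul, Set.inter_comm]
  exact hS

/-- If `C × C` avoids the measurable set `D` off the diagonal, then so does, up to a null set,
the square of a measurable hull of `C`. -/
lemma ae_notMem_of_hull {Ω : Type*} [MeasurableSpace Ω] [MeasurableSingletonClass Ω]
    {ν : Measure Ω} [IsProbabilityMeasure ν] [NullSingletonClass ν]
    {D : Set (Ω × Ω)} (hD : MeasurableSet D) {C : Set Ω}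
    (h : ∀ x ∈ C, ∀ y ∈ C, x ≠ y → (x, y) ∉ D) :
    ∀ᵐ p ∂ν.prod ν, p ∈ toMeasurable ν C ×ˢ toMeasurable ν C → p ∉ D := by
  set A := toMeasurable ν C
  have hA : MeasurableSet A := measurableSet_toMeasurable ν C
  -- Removing the section at `x` from the hull loses at most the null set `{x}` of `C`, so by
  -- minimality of the hull the removed part is null.
  have hsec : ∀ x ∈ C, ν (A ∩ Prod.mk x ⁻¹' D) = 0 := by
    intro x hx
    have hm : MeasurableSet (Prod.mk x ⁻¹' D) := measurable_prodMk_left hD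
    have hsub : C ⊆ A \ (Prod.mk x ⁻¹' D) ∪ {x} := by
      intro y hy
      by_cases hxy : y = x
      · exact Or.inr hxy
      · exact Or.inl ⟨subset_toMeasurable ν C hy, h x hx y hy (Ne.symm hxy)⟩
    have h1 : ν A ≤ ν (A \ (Prod.mk x ⁻¹' D)) := by
      calc ν A = ν C := measure_toMeasurable C
        _ ≤ ν (A \ (Prod.mk x ⁻¹' D) ∪ {x}) := measure_mono hsub
        _ ≤ ν (A \ (Prod.mk x ⁻¹' D)) + ν {x} := measure_union_le _ _
        _ = _ := by rw [measure_singleton, add_zero]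
    have h2 := measure_inter_add_sdiff (μ := ν) A hm
    have h3 : ν (A ∩ Prod.mk x ⁻¹' D) + ν (A \ (Prod.mk x ⁻¹' D)) ≤
        0 + ν (A \ (Prod.mk x ⁻¹' D)) := by rw [h2, zero_add]; exact h1
    exact le_antisymm ((ENNReal.add_le_add_iff_right (measure_ne_top _ _)).1 h3) bot_le
  have hAD : MeasurableSet (Set.univ ×ˢ A ∩ D) := (MeasurableSet.univ.prod hA).inter hD
  have hZ : MeasurableSet {x | ν (A ∩ Prod.mk x ⁻¹' D) = 0} := by
    have := measurable_measure_prodMk_left (ν := ν) hAD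
    have heq : ∀ x, Prod.mk x ⁻¹' (Set.univ ×ˢ A ∩ D) = A ∩ Prod.mk x ⁻¹' D := by
      intro x; ext y; simp
    simp only [heq] at this
    exact this (measurableSet_singleton 0)
  -- Minimality again: the points with null section form a measurable set containing `C`, hence
  -- almost all of the hull.
  have hZA : ∀ᵐ x ∂ν, x ∈ A → ν (A ∩ Prod.mk x ⁻¹' D) = 0 := by
    have h1 : ν A ≤ ν (A ∩ {x | ν (A ∩ Prod.mk x ⁻¹' D) = 0}) := by
      rw [measure_toMeasurable]
      exact measure_mono fun x hx => ⟨subset_toMeasurable ν C hx, hsec x hx⟩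
    have h2 := measure_inter_add_sdiff (μ := ν) A hZ
    have h3 : ν (A \ {x | ν (A ∩ Prod.mk x ⁻¹' D) = 0}) = 0 := by
      have : ν (A ∩ {x | ν (A ∩ Prod.mk x ⁻¹' D) = 0}) +
          ν (A \ {x | ν (A ∩ Prod.mk x ⁻¹' D) = 0}) ≤
          ν (A ∩ {x | ν (A ∩ Prod.mk x ⁻¹' D) = 0}) + 0 := by rw [h2, add_zero]; exact h1
      exact le_antisymm ((ENNReal.add_le_add_iff_left (measure_ne_top _ _)).1 this) bot_le
    filter_upwards [measure_eq_zero_iff_ae_notMem.1 h3] with x hx hxA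
    by_contra hne
    exact hx ⟨hxA, hne⟩
  have hmeas : MeasurableSet {p : Ω × Ω | p ∈ A ×ˢ A → p ∉ D} := by
    have : {p : Ω × Ω | p ∈ A ×ˢ A → p ∉ D} = (A ×ˢ A ∩ D)ᶜ := by
      ext p; simp
    rw [this]
    exact ((hA.prod hA).inter hD).compl
  refine (Measure.ae_prod_iff_ae_ae hmeas).2 ?_
  filter_upwards [hZA] with x hx
  by_cases hxA : x ∈ A
  · filter_upwards [measure_eq_zero_iff_ae_notMem.1 (hx hxA)] with y hy hp hyD
    exact hy ⟨hp.2, hyD⟩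
  · exact Eventually.of_forall fun y hp => absurd hp.1 hxA

end Density

/-! ### From colorings of finite samples to a measurable coloring -/

section Support

variable {Ω : Type*} [MeasurableSpace Ω] {ν : Measure Ω}

/-- The graph on the index set of a tuple of points in which two indices are joined if `W` is
positive at the corresponding points. -/
def supportGraph (W : Graphon ν) {V : Type*} (x : V → Ω) : SimpleGraph V where
  Adj u v := u ≠ v ∧ 0 < W.toFun (x u) (x v)
  symm := ⟨fun u v h => ⟨h.1.symm, by rw [W.symm']; exact h.2⟩⟩
  loopless := ⟨fun _ h => h.1 rfl⟩

/-- If for almost all finite tuples the support graph is `k`-colorable, then `W` has a proper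
coloring with `k` colors. -/
theorem exists_isProperColoring [StandardBorelSpace Ω] [IsProbabilityMeasure ν]
    [NullSingletonClass ν] (W : Graphon ν) (k : ℕ)
    (h : ∀ n, ∀ᵐ y ∂(Measure.pi fun _ : Fin n => ν), (W.supportGraph y).Colorable k) :
    ∃ f : Ω → Fin k, W.IsProperColoring f := by
  classical
  set S : Set (Ω × Ω) := {p | 0 < W.toFun p.1 p.2}
  have hS : MeasurableSet S := measurableSet_lt measurable_const W.measurable'
  obtain ⟨U, hdens⟩ := exists_density_basis ν hS
  -- Deleting a measurable null set makes every point of `D`, not just almost every one, a density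
  -- point of `S`; compactness needs this, as it tests arbitrary finite tuples.
  set N := toMeasurable (ν.prod ν) {p | ¬ (p ∈ S →
        Tendsto (fun r => (ν.prod ν)[|U p.1 r ×ˢ U p.2 r] S) (𝓝[>] 0) (𝓝 1))} with hN
  have hN0 : ν.prod ν N = 0 := by rw [hN, measure_toMeasurable]; exact hdens
  have hNm : MeasurableSet N := measurableSet_toMeasurable _ _
  set D := S \ N
  have hD : MeasurableSet D := hS.diff hNm
  have hDt : ∀ p ∈ D, Tendsto (fun r => (ν.prod ν)[|U p.1 r ×ˢ U p.2 r] S) (𝓝[>] 0) (𝓝 1) := by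
    intro p hp
    by_contra hcon
    exact hp.2 (subset_toMeasurable _ _ fun h => hcon (h hp.1))
  let G : SimpleGraph Ω := SimpleGraph.fromRel fun x y => (x, y) ∈ D
  have hfin : ∀ (n : ℕ) (z : Fin n → Ω), (G.comap z).Colorable k := by
    intro n z
    -- Chosen for the union bound over `n * n` ordered pairs: the total failure probability is at
    -- most `n² / (n² + 1) < 1`.
    set ε : ENNReal := (n * n + 1 : ENNReal)⁻¹ with hε
    have hε0 : ε ≠ 0 := by simp [hε, ENNReal.mul_eq_top]
    have hε1 : (1 : ENNReal) - ε < 1 := ENNReal.sub_lt_self (by simp) (by simp) hε0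
    have hev : ∀ᶠ r in 𝓝[>] (0 : ℝ), ∀ i j, (z i, z j) ∈ D →
        1 - ε < (ν.prod ν)[|U (z i) r ×ˢ U (z j) r] S := by
      refine eventually_all.2 fun i => eventually_all.2 fun j => ?_
      by_cases hij : (z i, z j) ∈ D
      · filter_upwards [(hDt _ hij).eventually (lt_mem_nhds hε1)] with r hr _ using hr
      · exact Eventually.of_forall fun r hr => absurd hr hij
    obtain ⟨r, hr⟩ := hev.exists
    -- The default `Set.univ` only keeps each `μ i` a probability measure; an index that uses it
    -- lies in no pair of `D`.
    let B : Fin n → Set Ω := fun i => if ν (U (z i) r) = 0 then Set.univ else U (z i) r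
    have hBpos : ∀ i, ν (B i) ≠ 0 := by
      intro i
      by_cases h0 : ν (U (z i) r) = 0
      · simp [B, h0]
      · simp only [B, if_neg h0]; exact h0
    let μ : Fin n → Measure Ω := fun i => ν[|B i]
    have hμ : ∀ i, IsProbabilityMeasure (μ i) := fun i => cond_isProbabilityMeasure (hBpos i)
    have hac : Measure.pi μ ≪ Measure.pi fun _ : Fin n => ν :=
      pi_absolutelyContinuous (fun i => (ν (B i))⁻¹) B fun _ => rfl
    have hpair : ∀ i j, (z i, z j) ∈ D → ((μ i).prod (μ j)) Sᶜ ≤ ε := by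
      intro i j hij
      have hlt := hr i j hij
      have hne : (ν.prod ν) (U (z i) r ×ˢ U (z j) r) ≠ 0 := by
        intro h0
        rw [cond_eq_zero_of_meas_eq_zero h0] at hlt
        simp at hlt
      rw [Measure.prod_prod] at hne
      have hi : B i = U (z i) r := if_neg (left_ne_zero_of_mul hne)
      have hj : B j = U (z j) r := if_neg (right_ne_zero_of_mul hne)
      have hprod : (μ i).prod (μ j) = (ν.prod ν)[|U (z i) r ×ˢ U (z j) r] := by
        simp only [μ, hi, hj]
        exact cond_prod_cond ν
      rw [prob_compl_eq_one_sub hS, hprod]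
      exact tsub_le_iff_tsub_le.1 hlt.le
    let bad : Set (Fin n → Ω) :=
      ⋃ i, ⋃ j, {y | i ≠ j ∧ (z i, z j) ∈ D ∧ (y i, y j) ∈ Sᶜ}
    have hbad : Measure.pi μ bad < 1 := by
      have hterm : ∀ i j, Measure.pi μ {y | i ≠ j ∧ (z i, z j) ∈ D ∧ (y i, y j) ∈ Sᶜ} ≤ ε := by
        intro i j
        by_cases hij : i ≠ j ∧ (z i, z j) ∈ D
        · calc _ ≤ Measure.pi μ ((fun y => (y i, y j)) ⁻¹' Sᶜ) := measure_mono fun y hy => hy.2.2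
            _ = ((μ i).prod (μ j)) Sᶜ := (measurePreserving_eval_pair μ hij.1).measure_preimage
                hS.compl.nullMeasurableSet
            _ ≤ ε := hpair i j hij.2
        · have : {y : Fin n → Ω | i ≠ j ∧ (z i, z j) ∈ D ∧ (y i, y j) ∈ Sᶜ} = ∅ := by
            ext y
            simp only [Set.mem_ofPred_eq, Set.mem_empty_iff_false, iff_false]
            exact fun hy => hij ⟨hy.1, hy.2.1⟩
          rw [this, measure_empty]
          exact bot_le
      calc Measure.pi μ bad
          ≤ ∑ i : Fin n, ∑ j : Fin n, ε :=
            (measure_iUnion_fintype_le _ _).trans <| Finset.sum_le_sum fun i _ =>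
              (measure_iUnion_fintype_le _ _).trans <| Finset.sum_le_sum fun j _ => hterm i j
        _ = (n * n : ENNReal) / (n * n + 1) := by
            simp only [Finset.sum_const, Finset.card_univ, Fintype.card_fin, nsmul_eq_mul, hε,
              div_eq_mul_inv, mul_assoc]
        _ < 1 := by
            refine ENNReal.div_lt_of_lt_mul' ?_
            rw [mul_one]
            exact ENNReal.lt_add_right (by simp [ENNReal.mul_eq_top]) one_ne_zero
    -- Colorability holds almost surely under the resampling measure by absolute continuity, while
    -- `bad` does not have full measure.
    obtain ⟨y, hyc, hyb⟩ : ∃ y, (W.supportGraph y).Colorable k ∧ y ∉ bad := by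
      by_contra hcon
      push Not at hcon
      have : ∀ᵐ y ∂Measure.pi μ, y ∈ bad := by
        filter_upwards [hac.ae_le (h n)] with y hy using hcon y hy
      have huniv : bad =ᵐ[Measure.pi μ] Set.univ := eventuallyEq_univ.2 this
      rw [measure_congr huniv, measure_univ] at hbad
      exact lt_irrefl _ hbad
    have hyS : ∀ i j, i ≠ j → (z i, z j) ∈ D → 0 < W.toFun (y i) (y j) := by
      intro i j hij hDij
      by_contra hcon
      exact hyb (Set.mem_iUnion₂.2 ⟨i, j, hij, hDij, hcon⟩)
    refine hyc.mono_left fun i j hij => ?_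
    have hij' : z i ≠ z j ∧ ((z i, z j) ∈ D ∨ (z j, z i) ∈ D) := hij
    have hne : i ≠ j := fun h => hij'.1 (congrArg z h)
    refine ⟨hne, ?_⟩
    rcases hij'.2 with h1 | h1
    · exact hyS i j hne h1
    · rw [W.symm']; exact hyS j i hne.symm h1
  -- The De Bruijn–Erdős compactness theorem.
  have hG : Nonempty (G →g (⊤ : SimpleGraph (Fin k))) := by
    refine SimpleGraph.nonempty_hom_of_forall_finite_subgraph_hom fun G' hG' => ?_
    have := hG'.to_subtype
    let e := Finite.equivFin G'.verts
    let C := (hfin _ fun i => (e.symm i : Ω)).some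
    refine ⟨fun v => C (e v), fun {u v} huv => ?_⟩
    refine C.map_rel (a := e u) (b := e v) ?_
    rw [SimpleGraph.comap_adj, e.symm_apply_apply, e.symm_apply_apply]
    exact G'.adj_sub huv
  obtain ⟨c⟩ := hG
  set A : Fin k → Set Ω := fun i => toMeasurable ν (c ⁻¹' {i})
  have hA : ∀ i, MeasurableSet (A i) := fun i => measurableSet_toMeasurable _ _
  have hAind : ∀ i, ∀ᵐ p ∂ν.prod ν, p ∈ A i ×ˢ A i → W.toFun p.1 p.2 = 0 := by
    intro i
    have h1 := ae_notMem_of_hull (ν := ν) hD (C := c ⁻¹' {i}) fun x hx y hy hxy hxyD => by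
      have hadj : G.Adj x y := ⟨hxy, Or.inl hxyD⟩
      exact (c.map_rel hadj) (hx.trans hy.symm)
    filter_upwards [h1, measure_eq_zero_iff_ae_notMem.1 hN0] with p hp hpN hpA
    refine le_antisymm (not_lt.1 fun hpos => hp hpA ⟨hpos, hpN⟩) (W.nonneg' _ _)
  have hex : ∀ x, ∃ i, x ∈ A i := fun x => ⟨c x, subset_toMeasurable _ _ rfl⟩
  -- Each point receives the least color whose hull contains it.
  have hmin : ∀ x, ∃ i, x ∈ A i ∧ ∀ j < i, x ∉ A j := by
    intro x
    obtain ⟨i, hi, hlt⟩ := WellFounded.has_min (wellFounded_lt (α := Fin k)) {i | x ∈ A i} (hex x)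
    exact ⟨i, hi, fun j hj hxj => hlt j hxj hj⟩
  choose f hfA hfmin using hmin
  have hpre : ∀ i, f ⁻¹' {i} = A i \ ⋃ j ∈ Set.Iio i, A j := by
    intro i
    ext x
    simp only [Set.mem_preimage, Set.mem_singleton_iff, Set.mem_sdiff, Set.mem_iUnion, Set.mem_Iio,
      not_exists]
    refine ⟨?_, fun hx => le_antisymm ?_ ?_⟩
    · rintro rfl
      exact ⟨hfA x, hfmin x⟩
    · exact not_lt.1 fun hlt => hfmin x i hlt hx.1
    · exact not_lt.1 fun hlt => hx.2 _ hlt (hfA x)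
  have hfm : ∀ i, MeasurableSet (f ⁻¹' {i}) := fun i => by
    rw [hpre]
    exact (hA i).diff (MeasurableSet.biUnion (Set.to_countable _) fun j _ => hA j)
  refine ⟨f, measurable_to_countable' hfm, fun i => ⟨hfm i, ?_⟩⟩
  filter_upwards [hAind i] with p hp hpf
  refine hp ⟨?_, ?_⟩
  · have := hfA p.1; rwa [show f p.1 = i from hpf.1] at this
  · have := hfA p.2; rwa [show f p.2 = i from hpf.2] at this

/-! ### Densities and support graphs -/

lemma pairValue_mk (W : Graphon ν) {V : Type*} (x : V → Ω) (u v : V) :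
    W.pairValue x s(u, v) = W.toFun (x u) (x v) := rfl

lemma pairValue_nonneg (W : Graphon ν) {V : Type*} (x : V → Ω) (e : Sym2 V) :
    0 ≤ W.pairValue x e := by
  induction e with | _ u v => exact W.nonneg' _ _

lemma pairValue_le_one (W : Graphon ν) {V : Type*} (x : V → Ω) (e : Sym2 V) :
    W.pairValue x e ≤ 1 := by
  induction e with | _ u v => exact W.le_one' _ _

lemma measurable_pairValue (W : Graphon ν) {V : Type*} (e : Sym2 V) :
    Measurable fun x : V → Ω => W.pairValue x e := by
  induction e with
  | _ u v =>
    have h : Measurable fun x : V → Ω => (x u, x v) :=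
      (measurable_pi_apply u).prodMk (measurable_pi_apply v)
    exact W.measurable'.comp h

open Classical in
/-- The integrand of the induced density. -/
noncomputable def inducedWeight {V : Type*} [Fintype V] (H : SimpleGraph V) (W : Graphon ν)
    (x : V → Ω) : ℝ :=
  (∏ e ∈ H.edgeFinset, W.pairValue x e) * ∏ e ∈ Hᶜ.edgeFinset, (1 - W.pairValue x e)

lemma inducedWeight_nonneg {V : Type*} [Fintype V] (H : SimpleGraph V) (W : Graphon ν)
    (x : V → Ω) : 0 ≤ inducedWeight H W x :=
  mul_nonneg (Finset.prod_nonneg fun e _ => W.pairValue_nonneg x e)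
    (Finset.prod_nonneg fun e _ => sub_nonneg.2 (W.pairValue_le_one x e))

lemma inducedWeight_le_one {V : Type*} [Fintype V] (H : SimpleGraph V) (W : Graphon ν)
    (x : V → Ω) : inducedWeight H W x ≤ 1 :=
  mul_le_one₀ (Finset.prod_le_one (fun e _ => W.pairValue_nonneg x e)
      fun e _ => W.pairValue_le_one x e)
    (Finset.prod_nonneg fun e _ => sub_nonneg.2 (W.pairValue_le_one x e))
    (Finset.prod_le_one (fun e _ => sub_nonneg.2 (W.pairValue_le_one x e))
      fun e _ => sub_le_self _ (W.pairValue_nonneg x e))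

lemma measurable_inducedWeight {V : Type*} [Fintype V] (H : SimpleGraph V) (W : Graphon ν) :
    Measurable (inducedWeight H W) :=
  (Finset.measurable_fun_prod _ fun e _ => W.measurable_pairValue e).mul
    (Finset.measurable_fun_prod _ fun e _ => (W.measurable_pairValue e).const_sub 1)

/-- The induced density vanishes if and only if its integrand vanishes almost everywhere. -/
lemma inducedDensity_pos_iff [IsProbabilityMeasure ν] {V : Type*} [Fintype V] (H : SimpleGraph V)
    (W : Graphon ν) :
    0 < inducedDensity H W ↔
      ¬ ∀ᵐ x ∂(Measure.pi fun _ : V => ν), inducedWeight H W x = 0 := by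
  have hint : Integrable (inducedWeight H W) (Measure.pi fun _ : V => ν) :=
    Integrable.of_bound (C := 1) (measurable_inducedWeight H W).aestronglyMeasurable
      (Eventually.of_forall fun x => by
        rw [Real.norm_of_nonneg (inducedWeight_nonneg H W x)]
        exact inducedWeight_le_one H W x)
  have h0 := integral_eq_zero_iff_of_nonneg (inducedWeight_nonneg H W) hint
  have hnn : 0 ≤ inducedDensity H W := integral_nonneg (inducedWeight_nonneg H W)
  rw [hnn.lt_iff_ne, ne_comm]
  exact not_congr h0

/-- Edges contribute positive values of `W`, and at nonedges `W = 0`, so those factors equal `1`. -/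
lemma inducedWeight_supportGraph_pos (W : Graphon ν) {V : Type*} [Fintype V] (x : V → Ω) :
    0 < inducedWeight (W.supportGraph x) W x := by
  classical
  refine mul_pos (Finset.prod_pos fun e he => ?_) (Finset.prod_pos fun e he => ?_)
  · rw [SimpleGraph.mem_edgeFinset] at he
    induction e with | _ u v => exact he.2
  · rw [SimpleGraph.mem_edgeFinset] at he
    induction e with
    | _ u v =>
      obtain ⟨huv, hn⟩ := (SimpleGraph.compl_adj _ _ _).1 he
      have hle : W.toFun (x u) (x v) ≤ 0 := not_lt.1 fun hpos => hn ⟨huv, hpos⟩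
      rw [pairValue_mk]
      linarith

/-- There are finitely many graphs on `V`, and each one of zero induced density is the support graph
only on a null set. This makes perfection applicable to random samples. -/
lemma ae_inducedDensity_supportGraph_pos [IsProbabilityMeasure ν] (W : Graphon ν) {V : Type*}
    [Fintype V] :
    ∀ᵐ x ∂(Measure.pi fun _ : V => ν), 0 < inducedDensity (W.supportGraph x) W := by
  have h : ∀ H : SimpleGraph V, ∀ᵐ x ∂(Measure.pi fun _ : V => ν),
      ¬ 0 < inducedDensity H W → inducedWeight H W x = 0 := by
    intro H
    by_cases hH : 0 < inducedDensity H W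
    · exact Eventually.of_forall fun x hx => absurd hH hx
    · have := not_not.1 (mt (inducedDensity_pos_iff H W).2 hH)
      filter_upwards [this] with x hx _ using hx
  filter_upwards [ae_all_iff.2 h] with x hx
  by_contra hcon
  exact (W.inducedWeight_supportGraph_pos x).ne' (hx _ hcon)

open Classical in
/-- The integrand of the homomorphism density. -/
noncomputable def homWeight {V : Type*} [Fintype V] (H : SimpleGraph V) (W : Graphon ν)
    (x : V → Ω) : ℝ :=
  ∏ e ∈ H.edgeFinset, W.pairValue x e

lemma density_eq_integral {V : Type*} [Fintype V] (H : SimpleGraph V) (W : Graphon ν) :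
    density H W = ∫ x, homWeight H W x ∂(Measure.pi fun _ : V => ν) := rfl

lemma homWeight_nonneg {V : Type*} [Fintype V] (H : SimpleGraph V) (W : Graphon ν)
    (x : V → Ω) : 0 ≤ homWeight H W x :=
  Finset.prod_nonneg fun e _ => W.pairValue_nonneg x e

lemma homWeight_eq_zero {V : Type*} [Fintype V] {H : SimpleGraph V} {W : Graphon ν} {x : V → Ω}
    {u v : V} (huv : H.Adj u v) (h : W.toFun (x u) (x v) = 0) : homWeight H W x = 0 := by
  classical
  exact Finset.prod_eq_zero (i := s(u, v)) (by rw [SimpleGraph.mem_edgeFinset]; exact huv) h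

lemma homWeight_pos {V : Type*} [Fintype V] {H : SimpleGraph V} {W : Graphon ν} {x : V → Ω}
    (h : ∀ u v, H.Adj u v → 0 < W.toFun (x u) (x v)) : 0 < homWeight H W x := by
  classical
  refine Finset.prod_pos fun e he => ?_
  rw [SimpleGraph.mem_edgeFinset] at he
  induction e with | _ u v => exact h u v he

lemma ae_homWeight_eq_zero [IsProbabilityMeasure ν] {V : Type*} [Fintype V] {H : SimpleGraph V}
    {W : Graphon ν} (h : ¬ 0 < density H W) :
    ∀ᵐ x ∂(Measure.pi fun _ : V => ν), homWeight H W x = 0 := by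
  have hint : Integrable (homWeight H W) (Measure.pi fun _ : V => ν) := by
    refine Integrable.of_bound (C := 1)
      (Finset.measurable_fun_prod _ fun e _ => W.measurable_pairValue e).aestronglyMeasurable
      (Eventually.of_forall fun x => ?_)
    rw [Real.norm_of_nonneg (homWeight_nonneg H W x)]
    exact Finset.prod_le_one (fun e _ => W.pairValue_nonneg x e) fun e _ => W.pairValue_le_one x e
  rw [density_eq_integral] at h
  exact (integral_eq_zero_iff_of_nonneg (homWeight_nonneg H W) hint).1
    (le_antisymm (not_lt.1 h) (integral_nonneg (homWeight_nonneg H W)))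

/-- If `t(K_r, W) = 0`, then almost no support graph contains a clique of order `r`. -/
lemma ae_cliqueFree_supportGraph [IsProbabilityMeasure ν] (W : Graphon ν) {r : ℕ}
    (hr : ¬ 0 < density (⊤ : SimpleGraph (Fin r)) W) {V : Type*} [Fintype V] :
    ∀ᵐ x ∂(Measure.pi fun _ : V => ν), (W.supportGraph x).CliqueFree r := by
  have hemb : ∀ s : Fin r ↪ V, ∀ᵐ x ∂(Measure.pi fun _ : V => ν),
      homWeight (⊤ : SimpleGraph (Fin r)) W (fun k => x (s k)) = 0 :=
    fun s => (measurePreserving_comp_injective ν s.injective).quasiMeasurePreserving.ae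
      (ae_homWeight_eq_zero hr)
  filter_upwards [ae_all_iff.2 hemb] with x hx
  by_contra hcon
  obtain ⟨φ⟩ := SimpleGraph.not_cliqueFree_iff_top_isContained r |>.1 hcon
  exact (homWeight_pos fun u v huv => (φ.toHom.map_rel huv).2).ne' (hx φ.toEmbedding)

/-- By pigeonhole two of the `r` points share a color, which kills a factor of the integrand. -/
lemma density_not_pos_of_isProperColoring [IsProbabilityMeasure ν] (W : Graphon ν) {k r : ℕ}
    {f : Ω → Fin k} (hf : W.IsProperColoring f) (hkr : k < r) :
    ¬ 0 < density (⊤ : SimpleGraph (Fin r)) W := by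
  have hpair : ∀ (i j : Fin r) (c : Fin k), i ≠ j → ∀ᵐ x ∂(Measure.pi fun _ : Fin r => ν),
      f (x i) = c → f (x j) = c → W.toFun (x i) (x j) = 0 := by
    intro i j c hij
    filter_upwards [(measurePreserving_eval_pair (fun _ => ν) hij).quasiMeasurePreserving.ae
      (hf.2 c).2] with x hx hi hj
    exact hx ⟨hi, hj⟩
  have hall : ∀ᵐ x ∂(Measure.pi fun _ : Fin r => ν), ∀ (i j : Fin r) (c : Fin k), i ≠ j →
      f (x i) = c → f (x j) = c → W.toFun (x i) (x j) = 0 := by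
    simp only [eventually_all]
    exact fun i j c hij => hpair i j c hij
  refine not_lt.2 (le_of_eq (integral_eq_zero_of_ae ?_))
  filter_upwards [hall] with x hx
  obtain ⟨i, j, hij, hfij⟩ := Fintype.exists_ne_map_eq_of_card_lt (fun i => f (x i)) (by simpa)
  exact homWeight_eq_zero (H := ⊤) hij (hx i j _ hij rfl hfij.symm)

lemma cliqueNumber_le_chromaticNumber [IsProbabilityMeasure ν] (W : Graphon ν) :
    W.cliqueNumber ≤ W.chromaticNumber := by
  refine sSup_le ?_
  rintro _ ⟨r, rfl, hr⟩
  refine le_sInf ?_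
  rintro _ ⟨k, rfl, f, hf⟩
  exact_mod_cast not_lt.1 fun hkr => W.density_not_pos_of_isProperColoring hf hkr hr

/-- The chromatic number of a subgraph-perfect graphon equals its clique number. -/
theorem IsSubgraphPerfect.chromaticNumber_eq [StandardBorelSpace Ω] [IsProbabilityMeasure ν]
    [NullSingletonClass ν] {W : Graphon ν} (hW : W.IsSubgraphPerfect) :
    W.chromaticNumber = W.cliqueNumber := by
  refine le_antisymm ?_ W.cliqueNumber_le_chromaticNumber
  rcases eq_or_ne W.cliqueNumber ⊤ with htop | htop
  · rw [htop]; exact le_top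
  obtain ⟨r, hr⟩ := ENat.ne_top_iff_exists.1 htop
  rw [← hr]
  have hdens : ¬ 0 < density (⊤ : SimpleGraph (Fin (r + 1))) W := by
    intro hpos
    have : ((r + 1 : ℕ) : ℕ∞) ≤ W.cliqueNumber := le_sSup ⟨r + 1, rfl, hpos⟩
    rw [← hr] at this
    have := Nat.cast_le.1 this
    omega
  refine sInf_le ⟨r, rfl, W.exists_isProperColoring r fun n => ?_⟩
  filter_upwards [W.ae_inducedDensity_supportGraph_pos (V := Fin n),
    W.ae_cliqueFree_supportGraph hdens (V := Fin n)] with y hy hfree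
  have hchi := hW n _ hy
  refine SimpleGraph.chromaticNumber_le_iff_colorable.1 (hchi.trans_le (Nat.cast_le.2 ?_))
  obtain ⟨s, hs⟩ := (W.supportGraph y).exists_isNClique_cliqueNum
  by_contra hlt
  exact hfree.mono (by omega) s hs

end Support

/-! ### Passage to subgraphons -/

section Restrict

variable {Ω : Type*} [MeasurableSpace Ω] {ν : Measure Ω}

lemma map_subMeasure {A : Set Ω} (hA : MeasurableSet A) :
    (subMeasure ν A).map (Subtype.val : A → Ω) = (ν A)⁻¹ • ν.restrict A := by
  rw [subMeasure, Measure.map_smul, map_comap_subtype_coe hA]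

lemma isProbabilityMeasure_subMeasure [IsFiniteMeasure ν] {A : Set Ω} (hA : MeasurableSet A)
    (hpos : ν A ≠ 0) : IsProbabilityMeasure (subMeasure ν A) := by
  refine ⟨?_⟩
  have h := congrArg (fun m => m Set.univ) (map_subMeasure (ν := ν) hA)
  simp only [Measure.map_apply measurable_subtype_coe MeasurableSet.univ, Set.preimage_univ,
    Measure.smul_apply, Measure.restrict_apply_univ, smul_eq_mul] at h
  rw [h, ENNReal.inv_mul_cancel hpos (measure_ne_top _ _)]

lemma nullSingletonClass_subMeasure [MeasurableSingletonClass Ω] [NullSingletonClass ν]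
    {A : Set Ω} (hA : MeasurableSet A) : NullSingletonClass (subMeasure ν A) := by
  refine ⟨fun x => ?_⟩
  have h := congrArg (fun m => m {(x : Ω)}) (map_subMeasure (ν := ν) hA)
  simp only [Measure.map_apply measurable_subtype_coe (measurableSet_singleton _),
    Measure.smul_apply] at h
  have hx : (Subtype.val : A → Ω) ⁻¹' {(x : Ω)} = {x} := by ext y; simp [Subtype.ext_iff]
  rw [hx] at h
  rw [h, measure_singleton, smul_zero]

/-- Subgraph-perfection passes to subgraphons. -/
lemma IsSubgraphPerfect.restrict [IsProbabilityMeasure ν] {W : Graphon ν}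
    (hW : W.IsSubgraphPerfect) {A : Set Ω} (hA : MeasurableSet A) (hpos : ν A ≠ 0) :
    (W.restrict A).IsSubgraphPerfect := by
  have hprob := isProbabilityMeasure_subMeasure hA hpos
  intro n H hH
  refine hW n H ?_
  rw [inducedDensity_pos_iff] at hH ⊢
  refine mt (fun h => ?_) hH
  have hmp : (Measure.pi fun _ : Fin n => subMeasure ν A).map (fun y i => (y i : Ω)) =
      Measure.pi fun _ => (subMeasure ν A).map (Subtype.val : A → Ω) :=
    Measure.pi_map_pi fun _ => measurable_subtype_coe.aemeasurable
  have hsf := Measure.isProbabilityMeasure_map (μ := subMeasure ν A)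
    (measurable_subtype_coe (p := (· ∈ A))).aemeasurable
  -- Almost sure vanishing on `Ω` transfers to samples from `A`, whose law is absolutely continuous
  -- with respect to the power of `ν`.
  have hac := pi_absolutelyContinuous (ι := Fin n) (ν := ν)
    (μ := fun _ => (subMeasure ν A).map (Subtype.val : A → Ω)) (fun _ => (ν A)⁻¹) (fun _ => A)
    fun _ => map_subMeasure hA
  have h1 := hac.ae_le h
  rw [← hmp] at h1
  have h2 := ae_of_ae_map (measurable_pi_lambda _ fun i =>
    measurable_subtype_coe.comp (measurable_pi_apply i)).aemeasurable h1
  have hpv : ∀ (y : Fin n → A) (e : Sym2 (Fin n)),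
      (W.restrict A).pairValue y e = W.pairValue (fun i => (y i : Ω)) e := by
    intro y e
    induction e with | _ u v => rfl
  filter_upwards [h2] with y hy
  simpa only [inducedWeight, hpv, Function.comp_apply] using hy

end Restrict

end Graphon

theorem theorem6 {Ω : Type*} [MeasurableSpace Ω] [StandardBorelSpace Ω]
    (ν : Measure Ω) [IsProbabilityMeasure ν] [NullSingletonClass ν]
    (W : Graphon ν) (hW : W.IsProperlySubgraphPerfect) :
    W.IsInheritancePerfect := by
  intro A hA hpos
  have := Graphon.isProbabilityMeasure_subMeasure hA hpos.ne'
  have := Graphon.nullSingletonClass_subMeasure (ν := ν) hA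
  have := hA.standardBorel
  exact (hW.1.restrict hA hpos.ne').chromaticNumber_eq
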